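/- A variety of groups is the class of all groups satisfying a fixed system of identities. For varieties $\mathcal U$ and $\mathcal V$, the product variety $\mathcal{UV}$ is the class of all groups $G$ having a normal subgroup $N\in\mathcal U$ with $G/N\in\mathcal V$. Let $\mathcal G_n$ be the set of pairs $(G,(a_1,\dots,a_n))$, where $G$ is a group generated by the ordered tuple $(a_1,\dots,a_n)$, modulo the equivalence relation identifying $(G,(a_i))$ with $(H,(b_i))$ if $a_i\mapsto b_i$ $(1\le i\le n)$ extends to an isomorphism $G\to H$. The topology on $\mathcal G_n$ has as a base the sets $\{(H,B)\in\mathcal G_n \mid (H,B)\approx_r (G,A)\}$, where $(G,A)\in\mathcal G_n$, $r\in\mathbb N$, and $\approx_r$ means that the balls of radius $r$ around the identity in the Cayley graphs are isomorphic as rooted directed graphs with edges labelled by the indices of the generators. Let $\mathcal G=\bigcup_n\mathcal G_n$ be the topological union (a set is open if and only if its intersection with every $\mathcal G_n$ is open), where $\mathcal G_n$ is embedded in $\mathcal G_{n+1}$ by $(G,(a_1,\dots,a_n))\mapsto(G,(a_1,\dots,a_n,1))$. A finitely generated group $G$ is condensed if its isomorphism class $[G]=\{(H,B)\in\mathcal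 G\mid H\cong G\}$ has no isolated points. An equivalence relation $E$ on a topological space $X$ is smooth if there are a Polish space $P$ and a Borel map $\beta\colon X\to P$ such that $xEy\iff\beta(x)=\beta(y)$ for all $x,y\in X$. **Corollary.** Suppose that $\mathcal U$ is a non-abelian variety of groups (it contains a non-abelian group) and $\mathcal V$ is a non-locally-finite variety of groups (it contains a group with an infinite finitely generated subgroup). Then the product variety $\mathcal{UV}$ contains a condensed group. Moreover: (a) the isomorphism relation on the subspace $\{(G,A)\in\mathcal G\mid G\in\mathcal{UV}\}$ of $\mathcal G$ is not smooth; (b) $\mathcal{UV}$ contains a subset of cardinality $2^{\aleph_0}$ consisting of pairwise non-isomorphic, elementarily equivalent (in the first-order language of groups), finitely generated groups. -/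

import Mathlib

open scoped Cardinal

universe u v w

/-! ### Varieties of groups -/

/-- A class of groups. -/
abbrev GroupClass : Type (u + 1) := ∀ (G : Type u) [Group G], Prop

/-- `G` satisfies the identities `w = 1` for all words `w ∈ L`
(in countably many variables). -/
def SatisfiesLaws (L : Set (FreeGroup ℕ)) (G : Type u) [Group G] : Prop :=
  ∀ w ∈ L, ∀ φ : FreeGroup ℕ →* G, φ w = 1

/-- A variety is the class of all groups satisfying a fixed system of identities. -/
def IsVariety (C : GroupClass.{u}) : Prop :=
  ∃ L : Set (FreeGroup ℕ), ∀ (G : Type u) [Group G], C G ↔ SatisfiesLaws L G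

/-- Every group of the class is abelian. -/
def IsAbelianClass (C : GroupClass.{u}) : Prop :=
  ∀ (G : Type u) [Group G], C G → ∀ a b : G, a * b = b * a

/-- A group is locally finite if its finitely generated subgroups are finite. -/
def IsLocallyFiniteGroup (G : Type u) [Group G] : Prop :=
  ∀ H : Subgroup G, H.FG → Finite H

/-- Every group of the class is locally finite. -/
def IsLocallyFiniteClass (C : GroupClass.{u}) : Prop :=
  ∀ (G : Type u) [Group G], C G → IsLocallyFiniteGroup G

/-- The product `UV`: all extensions of groups from `U` (the normal subgroup) by groups
from `V` (the quotient). -/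
def productClass (U V : GroupClass.{u}) : GroupClass.{u} := fun G _ =>
  ∃ (N : Subgroup G) (_ : N.Normal), U N ∧ V (G ⧸ N)

/-! ### The space of finitely generated marked groups -/

/-- A group together with an ordered `n`-tuple of generators. -/
structure MarkedGroup (n : ℕ) : Type (u + 1) where
  carrier : Type u
  [group : Group carrier]
  gen : Fin n → carrier
  closure_gen : Subgroup.closure (Set.range gen) = ⊤

attribute [instance] MarkedGroup.group

namespace MarkedGroup

/-- The vertices of the ball of radius `r` around `1` in the Cayley graph: the elements that
are represented by words of length at most `r` in the generators and their inverses. -/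
def ball {n : ℕ} (X : MarkedGroup.{u} n) (r : ℕ) : Set X.carrier :=
  {g | ∃ w : FreeGroup (Fin n), w.norm ≤ r ∧ FreeGroup.lift X.gen w = g}

/-- The relation `≈ᵣ`: there is an isomorphism between the balls of radius `r` around the
identity in the Cayley graphs (as rooted directed graphs, where the edges labelled `i` are the
pairs `(g, g aᵢ)`) that preserves the labels of edges. -/
def Similar {n : ℕ} (r : ℕ) (X : MarkedGroup.{u} n) (Y : MarkedGroup.{u} n) : Prop :=
  ∃ f : X.carrier → Y.carrier, Set.BijOn f (X.ball r) (Y.ball r) ∧ f 1 = 1 ∧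
    ∀ g ∈ X.ball r, ∀ h ∈ X.ball r, ∀ i : Fin n,
      h = g * X.gen i ↔ f h = f g * Y.gen i

/-- The relation `≈`: the map `aᵢ ↦ bᵢ` extends to an isomorphism. -/
instance equiv (n : ℕ) : Setoid (MarkedGroup.{u} n) where
  r X Y := ∃ f : X.carrier ≃* Y.carrier, ∀ i, f (X.gen i) = Y.gen i
  iseqv :=
    { refl := fun X => ⟨MulEquiv.refl _, fun _ => rfl⟩
      symm := fun ⟨f, hf⟩ => ⟨f.symm, fun i => by rw [← hf i, f.symm_apply_apply]⟩
      trans := fun ⟨f, hf⟩ ⟨g, hg⟩ => ⟨f.trans g, fun i => by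
        rw [MulEquiv.trans_apply, hf i, hg i]⟩ }

/-- The generators of a marked group, continued by `1` to an infinite sequence. -/
def genExt {n : ℕ} (X : MarkedGroup.{u} n) (k : ℕ) : X.carrier :=
  if h : k < n then X.gen ⟨k, h⟩ else 1

end MarkedGroup

/-- The space `𝒢ₙ` of groups marked by `n` generators. -/
def MarkedSpaceN (n : ℕ) : Type (u + 1) := Quotient (MarkedGroup.equiv.{u} n)

/-- The sets `{(H, B) | (H, B) ≈ᵣ (G, A)}` form a base of the topology of `𝒢ₙ`. -/
instance (n : ℕ) : TopologicalSpace (MarkedSpaceN.{u} n) :=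
  TopologicalSpace.generateFrom
    {S | ∃ (X : MarkedGroup.{u} n) (r : ℕ),
      S = {y | ∃ Y : MarkedGroup.{u} n, y = Quotient.mk _ Y ∧ Y.Similar r X}}

/-- Marked groups with any number of generators, where `(G, (a₁, …, aₙ))` is identified with
`(G, (a₁, …, aₙ, 1))`. -/
instance MarkedGroup.stableEquiv : Setoid (Σ n : ℕ, MarkedGroup.{u} n) where
  r X Y := ∃ f : X.2.carrier ≃* Y.2.carrier, ∀ k, f (X.2.genExt k) = Y.2.genExt k
  iseqv :=
    { refl := fun X => ⟨MulEquiv.refl _, fun _ => rfl⟩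
      symm := fun ⟨f, hf⟩ => ⟨f.symm, fun i => by rw [← hf i, f.symm_apply_apply]⟩
      trans := fun ⟨f, hf⟩ ⟨g, hg⟩ => ⟨f.trans g, fun i => by
        rw [MulEquiv.trans_apply, hf i, hg i]⟩ }

/-- The space `𝒢` of finitely generated marked groups, the union of the spaces `𝒢ₙ`. -/
def MarkedSpace : Type (u + 1) := Quotient MarkedGroup.stableEquiv.{u}

/-- The point `(G, A)` of `𝒢`. -/
def MarkedSpace.mk {n : ℕ} (X : MarkedGroup.{u} n) : MarkedSpace.{u} :=
  Quotient.mk MarkedGroup.stableEquiv ⟨n, X⟩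

/-- The embedding of `𝒢ₙ` into `𝒢`. -/
def MarkedSpaceN.toMarkedSpace (n : ℕ) : MarkedSpaceN.{u} n → MarkedSpace.{u} :=
  Quotient.lift MarkedSpace.mk (by
    rintro X Y ⟨f, hf⟩
    refine Quotient.sound ⟨f, fun k => ?_⟩
    by_cases h : k < n
    · simp [MarkedGroup.genExt, h, hf]
    · simp [MarkedGroup.genExt, h])

/-- The topology of the union: a set is open in `𝒢` if and only if its trace on every `𝒢ₙ`
is open. -/
instance : TopologicalSpace MarkedSpace.{u} :=
  ⨆ n : ℕ, TopologicalSpace.coinduced (MarkedSpaceN.toMarkedSpace.{u} n) inferInstance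

/-- The isomorphism class `[G] = {(H, B) ∈ 𝒢 | H ≅ G}`. -/
def isoClass (G : Type u) [Group G] : Set MarkedSpace.{u} :=
  {x | ∃ (n : ℕ) (X : MarkedGroup.{u} n), x = MarkedSpace.mk X ∧ Nonempty (X.carrier ≃* G)}

/-- A finitely generated group is condensed if `[G]` has no isolated points. -/
def IsCondensed (G : Type u) [Group G] : Prop :=
  Group.FG G ∧ Preperfect (isoClass G)

/-- The set `{(G, A) ∈ 𝒢 | G ∈ C}`. -/
def markedGroupsIn (C : GroupClass.{u}) : Set MarkedSpace.{u} :=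
  {x | ∃ (n : ℕ) (X : MarkedGroup.{u} n), x = MarkedSpace.mk X ∧ C X.carrier}

/-- The isomorphism relation on `𝒢`. -/
def isoRel : Setoid MarkedSpace.{u} where
  r x y := ∃ (m n : ℕ) (X : MarkedGroup.{u} m) (Y : MarkedGroup.{u} n),
    x = MarkedSpace.mk X ∧ y = MarkedSpace.mk Y ∧ Nonempty (X.carrier ≃* Y.carrier)
  iseqv :=
    { refl := fun x => Quotient.inductionOn x fun X =>
        ⟨X.1, X.1, X.2, X.2, rfl, rfl, ⟨MulEquiv.refl _⟩⟩
      symm := fun ⟨m, n, X, Y, hx, hy, ⟨f⟩⟩ => ⟨n, m, Y, X, hy, hx, ⟨f.symm⟩⟩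
      trans := by
        rintro x y z ⟨m, n, X, Y, hx, hy, ⟨f⟩⟩ ⟨k, l, Y', Z, hy', hz, ⟨g⟩⟩
        obtain ⟨e, -⟩ := Quotient.exact (hy.symm.trans hy')
        exact ⟨m, l, X, Z, hx, hz, ⟨(f.trans e).trans g⟩⟩ }

/-- An equivalence relation `E` on a topological space `X` is smooth if there are a Polish
space `P` and a Borel map `β : X → P` such that `x E y` if and only if `β x = β y`. -/
def IsSmoothRel {X : Type v} [TopologicalSpace X] (E : Setoid X) : Prop :=
  ∃ (P : Type w) (_ : TopologicalSpace P) (_ : PolishSpace P) (β : X → P),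
    @Measurable X P (borel X) (borel P) β ∧ ∀ x y, E x y ↔ β x = β y

/-! ### Elementary equivalence of groups -/

/-- The function symbols of the language of groups. -/
inductive GroupSymbol : ℕ → Type
  | mul : GroupSymbol 2
  | inv : GroupSymbol 1
  | one : GroupSymbol 0

/-- The first order language of groups. -/
def groupLanguage : FirstOrder.Language where
  Functions := GroupSymbol
  Relations := fun _ => Empty

/-- A group as a structure in the language of groups. -/
instance groupStructure (G : Type u) [Group G] : groupLanguage.Structure G where
  funMap := fun {_} s x =>
    match s, x with
    | GroupSymbol.mul, x => x 0 * x 1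
    | GroupSymbol.inv, x => (x 0)⁻¹
    | GroupSymbol.one, _ => 1
  RelMap := fun {_} s _ => nomatch s

/-! Take `a * b ≠ b * a` in a group M of U, and an infinite finitely generated group Q in V. All
subgroups of the wreath product of M and Q lie in UV. For x in the Cantor group, let G_x be the
subgroup generated by the generators of Q, by a and b supported at 1, and by a function f_x on Q
whose value is a or 1 on the terms of a sparse sequence, according to signs that encode x.

Three facts about the generating tuples matter (`TailFamily`). Each relation is a clopen condition
on x: around all but finitely many of its terms the sequence is too sparse for a word to see two
terms at once, so a far term matters only through its sign, and both signs recur arbitrarily far out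
for every x. The relations determine x: the commutator of f_x with a conjugate of b detects one
coordinate. Finite changes of x multiply f_x by conjugates of a and its inverse, so they preserve
G_x.

These facts suffice. Finite changes of x at ever later places give new markings of the same group
that converge to the original one, so G_0 is condensed. A countable group has countably many
n-tuples, so each isomorphism class among the G_x is countable, hence null for Haar measure. By the
zero-one law for tail sets, an isomorphism-invariant Borel map is constant almost everywhere, which
excludes smoothness; likewise each sentence is almost surely true or almost surely false in G_x, so
almost all G_x share one theory. -/

/-! ### Marked groups, their relations and the topology -/

namespace MarkedGroup

variable {n : ℕ}

/-- The value of a word on the generators of a marked group. -/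
def eval (X : MarkedGroup.{u} n) : FreeGroup (Fin n) →* X.carrier := FreeGroup.lift X.gen

lemma eval_surjective (X : MarkedGroup.{u} n) : Function.Surjective X.eval := by
  rw [← MonoidHom.range_eq_top, eval, FreeGroup.range_lift_eq_closure, X.closure_gen]

lemma finite_setOf_norm_le (n N : ℕ) : {w : FreeGroup (Fin n) | w.norm ≤ N}.Finite :=
  Set.Finite.of_finite_image ((List.finite_length_le (Fin n × Bool) N).subset (by
    rintro _ ⟨w, hw, rfl⟩
    exact hw)) FreeGroup.toWord_injective.injOn

lemma eval_eq_eval_iff {X Y : MarkedGroup.{u} n} {v w : FreeGroup (Fin n)}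
    (h : X.eval (v⁻¹ * w) = 1 ↔ Y.eval (v⁻¹ * w) = 1) :
    X.eval v = X.eval w ↔ Y.eval v = Y.eval w := by
  simpa [inv_mul_eq_one] using h

/-- Marked groups with the same relations of length at most `2 * r + 1` have the same balls of
radius `r`. -/
lemma similar_of_forall_norm_le {X Y : MarkedGroup.{u} n} {r : ℕ}
    (h : ∀ w : FreeGroup (Fin n), w.norm ≤ 2 * r + 1 → (X.eval w = 1 ↔ Y.eval w = 1)) :
    X.Similar r Y := by
  classical
  -- The endpoint of an edge leaving the ball is a word of length r + 1; comparing it with a word of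
  -- length r costs a relation of length 2r + 1.
  have key : ∀ v w : FreeGroup (Fin n), v.norm ≤ r → w.norm ≤ r + 1 →
      (X.eval v = X.eval w ↔ Y.eval v = Y.eval w) := by
    intro v w hv hw
    refine eval_eq_eval_iff (h _ ((FreeGroup.norm_mul_le _ _).trans ?_))
    rw [FreeGroup.norm_inv_eq]
    omega
  choose! u hu hu' using fun (g : X.carrier) (hg : g ∈ X.ball r) => hg
  refine ⟨fun g => Y.eval (u g), ⟨fun g hg => ⟨u g, hu g hg, rfl⟩, ?_, ?_⟩, ?_, ?_⟩
  · intro g hg g' hg' he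
    have := (key _ _ (hu g hg) ((hu g' hg').trans (Nat.le_succ r))).2 he
    exact (hu' g hg).symm.trans (this.trans (hu' g' hg'))
  · rintro _ ⟨w, hw, rfl⟩
    have hm : X.eval w ∈ X.ball r := ⟨w, hw, rfl⟩
    exact ⟨X.eval w, hm, (key _ _ (hu _ hm) (hw.trans (Nat.le_succ r))).1 (hu' _ hm)⟩
  · have hm : (1 : X.carrier) ∈ X.ball r := ⟨1, by simp, map_one _⟩
    have := (key _ 1 (hu _ hm) (by simp)).1 ((hu' _ hm).trans (map_one _).symm)
    simpa using this
  · intro g hg k hk i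
    have h1 := key (u k) (u g * FreeGroup.of i) (hu k hk)
      ((FreeGroup.norm_mul_le _ _).trans (by simpa using hu g hg))
    have e : ∀ Z : MarkedGroup.{u} n, Z.eval (FreeGroup.of i) = Z.gen i := fun Z => by simp [eval]
    have h2 : X.eval (u k) = k := hu' k hk
    have h3 : X.eval (u g) = g := hu' g hg
    rw [map_mul, map_mul, e, e, h2, h3] at h1
    exact h1

lemma Similar.trans {r : ℕ} {X Y Z : MarkedGroup.{u} n} (h : X.Similar r Y) (h' : Y.Similar r Z) :
    X.Similar r Z := by
  obtain ⟨f, hf, hf1, hfe⟩ := h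
  obtain ⟨g, hg, hg1, hge⟩ := h'
  refine ⟨g ∘ f, hg.comp hf, by simp [hf1, hg1], fun x hx y hy i => ?_⟩
  rw [hfe x hx y hy i, hge _ (hf.mapsTo hx) _ (hf.mapsTo hy) i]
  rfl

lemma similar_of_equiv {r : ℕ} {X Y : MarkedGroup.{u} n} (h : X ≈ Y) : X.Similar r Y := by
  obtain ⟨f, hf⟩ := h
  refine similar_of_forall_norm_le fun w _ => ?_
  have : Y.eval = f.toMonoidHom.comp X.eval := by
    ext i
    simp [eval, hf]
  simp [this]

/-- A family of marked groups in which every relation is a clopen condition on the parameter is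
continuous. -/
lemma continuous_mk {T : Type v} [TopologicalSpace T] (X : T → MarkedGroup.{u} n)
    (h : ∀ w, IsClopen {t | (X t).eval w = 1}) : Continuous fun t => MarkedSpace.mk (X t) := by
  have h1 : Continuous (MarkedSpaceN.toMarkedSpace.{u} n) := by
    rw [continuous_iff_coinduced_le]
    exact le_iSup (fun n => TopologicalSpace.coinduced (MarkedSpaceN.toMarkedSpace.{u} n) _) n
  let q : T → MarkedSpaceN n := fun t => Quotient.mk _ (X t)
  refine h1.comp (f := q) (continuous_generateFrom_iff.2 ?_)
  rintro _ ⟨Z, r, rfl⟩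
  rw [isOpen_iff_mem_nhds]
  rintro t ⟨Y, hY, hYZ⟩
  -- Only finitely many words are this short, so their clopen conditions are jointly constant near
  -- t.
  have h2 : ∀ᶠ s in nhds t, ∀ w ∈ {w : FreeGroup (Fin n) | w.norm ≤ 2 * r + 1},
      ((X s).eval w = 1 ↔ (X t).eval w = 1) := by
    rw [Filter.eventually_all_finite (finite_setOf_norm_le n _)]
    intro w _
    by_cases ht : (X t).eval w = 1
    · filter_upwards [(h w).isOpen.mem_nhds ht] with s hs using iff_of_true hs ht
    · filter_upwards [(h w).compl.isOpen.mem_nhds ht] with s hs using iff_of_false hs ht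
  filter_upwards [h2] with s hs
  exact ⟨X s, rfl, (similar_of_forall_norm_le hs).trans
    ((similar_of_equiv (Quotient.exact hY)).trans hYZ)⟩

lemma mk_eq_mk_iff {X Y : MarkedGroup.{u} n} :
    MarkedSpace.mk X = MarkedSpace.mk Y ↔ ∀ w, X.eval w = 1 ↔ Y.eval w = 1 := by
  constructor
  · intro h w
    obtain ⟨f, hf⟩ := Quotient.exact h
    have : Y.eval = f.toMonoidHom.comp X.eval := by
      ext i
      have := hf i
      simp only [genExt, i.2, dif_pos] at this
      simpa [eval] using this.symm
    simp [this]
  · intro h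
    have hk : X.eval.ker = Y.eval.ker := by
      ext w
      exact h w
    have : X ≈ Y := by
      refine ⟨(QuotientGroup.quotientKerEquivOfSurjective _ X.eval_surjective).symm.trans
        ((QuotientGroup.quotientMulEquivOfEq hk).trans
          (QuotientGroup.quotientKerEquivOfSurjective _ Y.eval_surjective)), fun i => ?_⟩
      have h1 : X.gen i = QuotientGroup.quotientKerEquivOfSurjective _ X.eval_surjective
          (QuotientGroup.mk (FreeGroup.of i)) := by
        change _ = X.eval (FreeGroup.of i)
        simp [eval]
      rw [h1, MulEquiv.trans_apply, MulEquiv.symm_apply_apply]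
      change Y.eval (FreeGroup.of i) = _
      simp [eval]
    exact congrArg (MarkedSpaceN.toMarkedSpace n) (Quotient.sound this)

/-- The subgroup generated by a tuple, marked by this tuple. -/
def ofTuple {W : Type u} [Group W] (t : Fin n → W) : MarkedGroup.{u} n where
  carrier := Subgroup.closure (Set.range t)
  gen i := ⟨t i, Subgroup.subset_closure ⟨i, rfl⟩⟩
  closure_gen := by
    rw [← Subgroup.closure_closure_coe_preimage (k := Set.range t)]
    congr 1
    ext ⟨g, hg⟩
    simp

lemma coe_eval_ofTuple {W : Type u} [Group W] (t : Fin n → W) (w : FreeGroup (Fin n)) :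
    (Subgroup.closure (Set.range t)).subtype ((ofTuple t).eval w) = FreeGroup.lift t w := by
  have : (Subgroup.closure (Set.range t)).subtype.comp (ofTuple t).eval = FreeGroup.lift t := by
    ext i
    change (Subgroup.closure (Set.range t)).subtype (FreeGroup.lift (ofTuple t).gen _) = _
    rw [FreeGroup.lift_apply_of, FreeGroup.lift_apply_of]
    rfl
  exact DFunLike.congr_fun this w

lemma eval_ofTuple_eq_one_iff {W : Type u} [Group W] {t : Fin n → W} {w : FreeGroup (Fin n)} :
    (ofTuple t).eval w = 1 ↔ FreeGroup.lift t w = 1 := by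
  rw [← coe_eval_ofTuple]
  exact (map_eq_one_iff _ (Subgroup.subtype_injective _)).symm

instance (X : MarkedGroup.{u} n) : Countable X.carrier := X.eval_surjective.countable

lemma group_fg (X : MarkedGroup.{u} n) : Group.FG X.carrier :=
  Group.fg_iff.2 ⟨_, X.closure_gen, Set.finite_range _⟩

end MarkedGroup

/-- A family of `n`-tuples of elements of a group `W`, indexed by the points of the Cantor group,
such that the relations between the members of the tuple are clopen conditions on the index and
determine the index, while a finite change of the index does not affect the subgroup generated by
the tuple. -/
structure TailFamily (W : Type u) [Group W] (n : ℕ) where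
  tuple : (ℕ → ZMod 2) → Fin n → W
  isClopen_setOf : ∀ w, IsClopen {x | FreeGroup.lift (tuple x) w = 1}
  eq_of_forall_iff : ∀ x y,
    (∀ w, FreeGroup.lift (tuple x) w = 1 ↔ FreeGroup.lift (tuple y) w = 1) → x = y
  closure_eq : ∀ x y, {k | x k ≠ y k}.Finite →
    Subgroup.closure (Set.range (tuple x)) = Subgroup.closure (Set.range (tuple y))

/-! ### The zero-one law -/

open MeasureTheory in
-- The measure is normalized Haar measure. It has no atoms because 0 is not isolated. A tail set is
-- invariant under the finitely supported sequences, which form a dense subgroup, and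
-- translation-invariance under a dense set forces a measurable set to be null or conull.
lemma exists_measure_eventuallyConst [MeasurableSpace (ℕ → ZMod 2)] [BorelSpace (ℕ → ZMod 2)] :
    ∃ μ : Measure (ℕ → ZMod 2), IsProbabilityMeasure μ ∧ NullSingletonClass μ ∧
      ∀ s : Set (ℕ → ZMod 2), MeasurableSet s →
        (∀ x y, {k | x k ≠ y k}.Finite → (x ∈ s ↔ y ∈ s)) → Filter.EventuallyConst s (ae μ) := by
  have hne : (nhdsWithin (0 : ℕ → ZMod 2) {0}ᶜ).NeBot := by
    rw [← mem_closure_iff_nhdsWithin_neBot]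
    refine mem_closure_of_tendsto (f := fun k : ℕ => (Pi.single k 1 : ℕ → ZMod 2))
      (b := Filter.atTop) ?_ (Filter.Eventually.of_forall fun k => by simp)
    refine tendsto_pi_nhds.2 fun i => tendsto_const_nhds.congr' ?_
    filter_upwards [Filter.eventually_gt_atTop i] with k hk
    simp [Pi.single_eq_of_ne hk.ne]
  refine ⟨Measure.addHaarMeasure ⊤, ⟨Measure.addHaarMeasure_self⟩,
    Measure.IsAddHaarMeasure.nullSingletonClass _, fun s hs h => ?_⟩
  refine aeconst_of_dense_setOfPred_preimage_vadd_eq (M := ℕ → ZMod 2) hs.nullMeasurableSet ?_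
  -- Density: the truncations of x are finitely supported and converge to x.
  intro x
  refine mem_closure_of_tendsto
    (f := fun N : ℕ => (fun k => if k < N then x k else 0 : ℕ → ZMod 2)) (b := Filter.atTop) ?_
    (Filter.Eventually.of_forall fun N => ?_)
  · refine tendsto_pi_nhds.2 fun i => tendsto_const_nhds.congr' ?_
    filter_upwards [Filter.eventually_gt_atTop i] with k hk
    simp [hk]
  · ext y
    refine h _ _ ((Set.finite_lt_nat N).subset fun k hk => ?_)
    by_contra hkN
    simp only [Set.mem_ofPred_eq] at hkN
    simp [hkN] at hk

/-! ### Sentences as Borel conditions -/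

namespace MarkedGroup

variable {n : ℕ}

open FirstOrder Language in
lemma exists_eval_term {α : Type} (t : groupLanguage.Term α) (v : α → FreeGroup (Fin n)) :
    ∃ w : FreeGroup (Fin n), ∀ X : MarkedGroup.{u} n, t.realize (fun a => X.eval (v a)) = X.eval w := by
  induction t with
  | var a => exact ⟨v a, fun X => rfl⟩
  | func f ts ih =>
    choose w hw using ih
    cases f with
    | mul =>
      refine ⟨w 0 * w 1, fun X => ?_⟩
      simp only [Term.realize, hw, map_mul]
      rfl
    | inv =>
      refine ⟨(w 0)⁻¹, fun X => ?_⟩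
      simp only [Term.realize, hw, map_inv]
      rfl
    | one => exact ⟨1, fun X => (map_one X.eval).symm⟩

open FirstOrder Language in
-- Every element is the value of a word, so a quantifier over the varying group becomes a countable
-- intersection over the fixed free group.
lemma measurableSet_setOf_realize {T : Type*} [MeasurableSpace T] (X : T → MarkedGroup.{u} n)
    (h : ∀ w, MeasurableSet {t | (X t).eval w = 1}) {k : ℕ}
    (φ : groupLanguage.BoundedFormula Empty k) (v : Fin k → FreeGroup (Fin n)) :
    MeasurableSet {t | φ.Realize (M := (X t).carrier) (fun a => a.elim)
      (fun i => (X t).eval (v i))} := by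
  induction φ with
  | falsum => exact MeasurableSet.empty
  | @equal k t₁ t₂ =>
    have key : ∀ t : groupLanguage.Term (Empty ⊕ Fin k), ∃ w : FreeGroup (Fin n),
        ∀ X : MarkedGroup.{u} n,
          t.realize (Sum.elim (fun a : Empty => a.elim) fun i => X.eval (v i)) = X.eval w := by
      intro t
      obtain ⟨w, hw⟩ := exists_eval_term.{u} t (Sum.elim (fun a : Empty => a.elim) v)
      refine ⟨w, fun X => (hw X).symm ▸ congrArg t.realize (funext fun a => ?_)⟩
      cases a with
      | inl a => exact a.elim
      | inr i => rfl
    obtain ⟨w₁, h₁⟩ := key t₁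
    obtain ⟨w₂, h₂⟩ := key t₂
    convert h (w₁⁻¹ * w₂) using 1
    ext t
    simp only [Set.mem_ofPred_eq, BoundedFormula.Realize, h₁, h₂, map_mul, map_inv, inv_mul_eq_one]
  | rel R => exact nomatch R
  | imp φ ψ hφ hψ =>
    convert (hφ v).compl.union (hψ v) using 1
    ext t
    simp only [Set.mem_ofPred_eq, BoundedFormula.Realize, Set.mem_union, Set.mem_compl_iff,
      imp_iff_not_or]
  | @all k φ ih =>
    convert MeasurableSet.iInter fun w : FreeGroup (Fin n) => ih (Fin.snoc v w) using 1
    ext t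
    simp only [Set.mem_ofPred_eq, BoundedFormula.Realize, Set.mem_iInter]
    rw [(X t).eval_surjective.forall]
    refine forall_congr' fun w => ?_
    have : (Fin.snoc (fun i => (X t).eval (v i)) ((X t).eval w) : Fin (k + 1) → (X t).carrier) =
        fun i => (X t).eval ((Fin.snoc v w : Fin (k + 1) → FreeGroup (Fin n)) i) := by
      funext i
      refine Fin.lastCases ?_ (fun i => ?_) i <;> simp
    rw [this]

end MarkedGroup

open FirstOrder Language in
lemma MulEquiv.elementarilyEquivalent {G H : Type u} [Group G] [Group H] (e : G ≃* H) :
    groupLanguage.ElementarilyEquivalent G H := by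
  let f : G ≃[groupLanguage] H :=
    { e.toEquiv with
      map_fun' := by
        intro k s x
        cases s with
        | mul => exact map_mul e _ _
        | inv => exact map_inv e _
        | one => exact map_one e
      map_rel' := fun r => nomatch r }
  exact StrongHomClass.elementarilyEquivalent f

/-! ### Consequences of a tail family -/

namespace TailFamily

variable {W : Type u} [Group W] {n : ℕ} (F : TailFamily W n)

/-- The marked group generated by a member of the family. -/
def marked (x : ℕ → ZMod 2) : MarkedGroup.{u} n := MarkedGroup.ofTuple (F.tuple x)

lemma lift_lift {m : ℕ} (t : Fin n → W) (v : Fin m → FreeGroup (Fin n)) (u : FreeGroup (Fin m)) :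
    FreeGroup.lift (fun j => FreeGroup.lift t (v j)) u =
      FreeGroup.lift t (FreeGroup.lift v u) := by
  have : FreeGroup.lift (fun j => FreeGroup.lift t (v j)) =
      (FreeGroup.lift t).comp (FreeGroup.lift v) := by
    ext j
    simp
  exact DFunLike.congr_fun this u

lemma eval_marked_eq_one_iff {x : ℕ → ZMod 2} {w : FreeGroup (Fin n)} :
    (F.marked x).eval w = 1 ↔ FreeGroup.lift (F.tuple x) w = 1 :=
  MarkedGroup.eval_ofTuple_eq_one_iff

lemma isClopen_setOf_eval_marked (w : FreeGroup (Fin n)) :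
    IsClopen {x | (F.marked x).eval w = 1} := by
  simpa only [eval_marked_eq_one_iff] using F.isClopen_setOf w

lemma eq_of_eval_marked {x y : ℕ → ZMod 2}
    (h : ∀ w, (F.marked x).eval w = 1 ↔ (F.marked y).eval w = 1) : x = y :=
  F.eq_of_forall_iff x y fun w => by simpa only [eval_marked_eq_one_iff] using h w

lemma nonempty_equiv {x y : ℕ → ZMod 2} (h : {k | x k ≠ y k}.Finite) :
    Nonempty ((F.marked x).carrier ≃* (F.marked y).carrier) :=
  ⟨MulEquiv.subgroupCongr (F.closure_eq x y h)⟩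

/-- An isomorphism carries the marking of the group at y to an n-tuple in one countable group. This
tuple has the same relations, so it determines y. -/
lemma countable_setOf_equiv (x : ℕ → ZMod 2) :
    {y | Nonempty ((F.marked y).carrier ≃* (F.marked x).carrier)}.Countable := by
  let e' : ∀ y : {y | Nonempty ((F.marked y).carrier ≃* (F.marked x).carrier)},
    (F.marked y).carrier ≃* (F.marked x).carrier := fun y => y.2.some
  refine Set.countable_coe_iff.1 (Function.Injective.countable
    (f := fun y i => e' y ((F.marked y.1).gen i)) fun y z hyz => Subtype.ext ?_)
  refine F.eq_of_eval_marked fun w => ?_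
  have key : ∀ y, (F.marked y.1).eval w = 1 ↔
      FreeGroup.lift (fun i => e' y ((F.marked y.1).gen i)) w = 1 := fun y => by
    have : FreeGroup.lift (fun i => e' y ((F.marked y.1).gen i)) =
        (e' y).toMonoidHom.comp (F.marked y.1).eval := by
      ext i
      simp [MarkedGroup.eval]
    simp [this]
  rw [key y, key z]
  exact Eq.congr (congrArg (fun t => FreeGroup.lift t w) hyz) rfl

/-- The groups in a tail family are condensed. -/
lemma isCondensed : IsCondensed (F.marked 0).carrier := by
  refine ⟨(F.marked 0).group_fg, ?_⟩
  rintro _ ⟨m, Y, rfl, ⟨e⟩⟩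
  have hc : ∀ g : (F.marked 0).carrier, ∃ w, (F.marked 0).eval w = g :=
    (F.marked 0).eval_surjective
  choose v hv using fun j => hc (e (Y.gen j))
  choose u hu using fun i => Y.eval_surjective (e.symm ((F.marked 0).gen i))
  -- The words v express the given marking Y through the family at 0; evaluated at x, they deform Y
  -- along the family.
  let B : (ℕ → ZMod 2) → Fin m → W := fun x j => FreeGroup.lift (F.tuple x) (v j)
  have hB : ∀ x w, FreeGroup.lift (B x) w = FreeGroup.lift (F.tuple x) (FreeGroup.lift v w) :=
    fun x w => lift_lift _ _ _
  have hY : (F.marked 0).eval.comp (FreeGroup.lift v) = e.toMonoidHom.comp Y.eval := by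
    ext j
    simpa [MarkedGroup.eval] using hv j
  have hY0 : MarkedSpace.mk Y = MarkedSpace.mk (MarkedGroup.ofTuple (B 0)) := by
    refine MarkedGroup.mk_eq_mk_iff.2 fun w => ?_
    rw [MarkedGroup.eval_ofTuple_eq_one_iff, hB, ← MarkedGroup.eval_ofTuple_eq_one_iff]
    have := DFunLike.congr_fun hY w
    change (F.marked 0).eval (FreeGroup.lift v w) = e (Y.eval w) at this
    change _ ↔ (F.marked 0).eval (FreeGroup.lift v w) = 1
    rw [this, map_eq_one_iff e e.injective]
  have hcont : Continuous fun x => MarkedSpace.mk (MarkedGroup.ofTuple (B x)) := by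
    refine MarkedGroup.continuous_mk _ fun w => ?_
    simpa only [MarkedGroup.eval_ofTuple_eq_one_iff, hB] using F.isClopen_setOf _
  -- The words u invert this substitution at 0. This is a finite set of relations, so it persists
  -- near 0, where `B x` and `F.tuple x` therefore generate the same subgroup.
  have hO : ∀ᶠ x in nhds (0 : ℕ → ZMod 2), ∀ i, FreeGroup.lift (B x) (u i) = F.tuple x i := by
    refine Filter.eventually_all.2 fun i => ?_
    have h0 : FreeGroup.lift (F.tuple 0) (FreeGroup.lift v (u i) * (FreeGroup.of i)⁻¹) = 1 := by
      refine MarkedGroup.eval_ofTuple_eq_one_iff.1 ?_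
      change (F.marked 0).eval _ = 1
      have := DFunLike.congr_fun hY (u i)
      change (F.marked 0).eval (FreeGroup.lift v (u i)) = e (Y.eval (u i)) at this
      rw [map_mul, this, hu, MulEquiv.apply_symm_apply, map_inv]
      simp [MarkedGroup.eval]
    filter_upwards [(F.isClopen_setOf _).isOpen.mem_nhds h0] with x hx
    rw [hB]
    simpa [mul_inv_eq_one] using hx
  have htend : Filter.Tendsto (fun k : ℕ => (Pi.single k 1 : ℕ → ZMod 2)) Filter.atTop
      (nhds 0) := by
    refine tendsto_pi_nhds.2 fun i => tendsto_const_nhds.congr' ?_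
    filter_upwards [Filter.eventually_gt_atTop i] with k hk
    simp [Pi.single_eq_of_ne hk.ne]
  rw [accPt_iff_nhds, hY0]
  intro U hU
  obtain ⟨k, hkU, hk⟩ := ((htend.eventually ((hcont.tendsto 0).eventually hU)).and
    (htend.eventually hO)).exists
  set x : ℕ → ZMod 2 := Pi.single k 1 with hx
  have hfin : {i | x i ≠ (0 : ℕ → ZMod 2) i}.Finite :=
    (Set.finite_singleton k).subset fun i hi => by
      by_contra hik
      exact hi (by simp [hx, Pi.single_eq_of_ne (Set.mem_singleton_iff.not.1 hik)])
  refine ⟨_, ⟨hkU, m, _, rfl, ⟨MulEquiv.subgroupCongr ?_⟩⟩, fun hxe => ?_⟩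
  · rw [← F.closure_eq x 0 hfin]
    refine le_antisymm ((Subgroup.closure_le _).2 ?_) ((Subgroup.closure_le _).2 ?_)
    · rintro _ ⟨j, rfl⟩
      rw [← FreeGroup.range_lift_eq_closure]
      exact ⟨v j, rfl⟩
    · rintro _ ⟨i, rfl⟩
      rw [← FreeGroup.range_lift_eq_closure]
      exact ⟨u i, hk i⟩
  · have h0 := hO.self_of_nhds
    -- Substituting u turns equal relations of `B x` and `B 0` into equal relations of the original
    -- tuples.
    have hx0 : x = 0 := F.eq_of_forall_iff _ _ fun w => by
      have := (MarkedGroup.mk_eq_mk_iff.1 hxe) (FreeGroup.lift u w)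
      simp only [MarkedGroup.eval_ofTuple_eq_one_iff, ← lift_lift] at this
      simpa only [hk, h0] using this
    simp [hx] at hx0

/-- A reduction β would be invariant under finite changes of x, hence almost everywhere constant, so
almost all parameters would lie in one isomorphism class; but such a class is null. -/
lemma not_isSmoothRel {C : GroupClass.{u}} (hC : ∀ x, C (F.marked x).carrier) :
    ¬ IsSmoothRel.{u + 1, w}
      (isoRel.{u}.comap (Subtype.val : markedGroupsIn C → MarkedSpace.{u})) := by
  rintro ⟨P, _, _, β, hβ, hE⟩
  borelize (ℕ → ZMod 2) P
  let : MeasurableSpace (markedGroupsIn C) := borel _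
  have : BorelSpace (markedGroupsIn C) := ⟨rfl⟩
  let ψ : (ℕ → ZMod 2) → markedGroupsIn C := fun x => ⟨MarkedSpace.mk (F.marked x), n, _, rfl, hC x⟩
  have hψ : Continuous ψ :=
    (MarkedGroup.continuous_mk _ F.isClopen_setOf_eval_marked).subtype_mk _
  have hiso : ∀ x y, β (ψ x) = β (ψ y) ↔
      Nonempty ((F.marked x).carrier ≃* (F.marked y).carrier) := by
    intro x y
    rw [← hE]
    refine ⟨fun ⟨m, k, X, Y, hX, hY, ⟨f⟩⟩ => ?_, fun h => ⟨n, n, _, _, rfl, rfl, h⟩⟩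
    obtain ⟨e, -⟩ := Quotient.exact hX
    obtain ⟨e', -⟩ := Quotient.exact hY
    exact ⟨(e.trans f).trans e'.symm⟩
  have hm : Measurable (β ∘ ψ) := hβ.comp hψ.measurable
  obtain ⟨μ, _, _, h01⟩ := exists_measure_eventuallyConst
  have : Nonempty P := ⟨β (ψ 0)⟩
  -- Countably many measurable sets separate the points of P, and the preimage of each is null or
  -- conull.
  obtain ⟨p, hp⟩ := Filter.exists_eventuallyEq_const_of_forall_separating (l := MeasureTheory.ae μ)
    (f := β ∘ ψ) MeasurableSet fun U hU => Filter.eventuallyConst_set.1 (h01 _ (hm hU)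
      fun x y hxy => by
        have : β (ψ x) = β (ψ y) := (hiso x y).2 (F.nonempty_equiv hxy)
        change β (ψ x) ∈ U ↔ β (ψ y) ∈ U
        rw [this])
  obtain ⟨x, hx⟩ := hp.exists
  have hnull := (F.countable_setOf_equiv x).measure_zero μ
  obtain ⟨y, hy, hy'⟩ := (hp.and (MeasureTheory.measure_eq_zero_iff_ae_notMem.1 hnull)).exists
  exact hy' ((hiso y x).1 (hy.trans hx.symm))

open FirstOrder Language in
lemma exists_elementarilyEquivalent {C : GroupClass.{u}} (hC : ∀ x, C (F.marked x).carrier) :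
    ∃ S : Set GrpCat.{u}, #S = 2 ^ ℵ₀ ∧ (∀ G ∈ S, C G ∧ Group.FG G) ∧
      (∀ G ∈ S, ∀ H ∈ S, G ≠ H → IsEmpty (G ≃* H)) ∧
      (∀ G ∈ S, ∀ H ∈ S, groupLanguage.ElementarilyEquivalent G H) := by
  borelize (ℕ → ZMod 2)
  obtain ⟨μ, _, _, h01⟩ := exists_measure_eventuallyConst
  have hms : ∀ φ : groupLanguage.Sentence,
      MeasurableSet {x | (F.marked x).carrier ⊨ φ} := fun φ => by
    convert MarkedGroup.measurableSet_setOf_realize F.marked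
      (fun w => (F.isClopen_setOf_eval_marked w).isOpen.measurableSet) φ Fin.elim0 using 1
    ext x
    simp only [Set.mem_ofPred_eq, Sentence.Realize, Formula.Realize]
    rw [Subsingleton.elim (default : Empty → (F.marked x).carrier) (fun a => a.elim),
      Subsingleton.elim (default : Fin 0 → (F.marked x).carrier)
        (fun i => (F.marked x).eval (Fin.elim0 i))]
  have : Countable groupLanguage.Symbols := by
    have : Countable (Σ l, groupLanguage.Functions l) := by
      refine Function.Injective.countable (β := ℕ) (f := fun s => s.1) ?_
      rintro ⟨_, a⟩ ⟨_, b⟩ h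
      cases a <;> cases b <;> simp_all
    have : IsEmpty (Σ l, groupLanguage.Relations l) := ⟨fun r => nomatch r.2⟩
    exact inferInstanceAs (Countable (_ ⊕ _))
  obtain ⟨T, hT⟩ : ∃ T : groupLanguage.Theory, ∀ φ : groupLanguage.Sentence,
      ∀ᵐ x ∂μ, ((F.marked x).carrier ⊨ φ ↔ φ ∈ T) := by
    -- T is the almost sure theory. A sentence defines a Borel tail set, so the zero-one law decides
    -- it.
    refine ⟨{φ | ∀ᵐ x ∂μ, (F.marked x).carrier ⊨ φ}, fun φ => ?_⟩
    rcases Filter.eventuallyConst_set.1 (h01 _ (hms φ) fun x y hxy =>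
      ((F.nonempty_equiv hxy).some.elementarilyEquivalent).realize_sentence φ) with h | h
    · filter_upwards [h] with x hx
      exact iff_of_true hx h
    · filter_upwards [h] with x hx
      refine iff_of_false hx fun h' => ?_
      obtain ⟨y, hy, hy'⟩ := (h.and h').exists
      exact hy hy'
  set Z : Set (ℕ → ZMod 2) := {x | ∀ φ : groupLanguage.Sentence,
    ((F.marked x).carrier ⊨ φ ↔ φ ∈ T)} with hZdef
  have hZ : ∀ᵐ x ∂μ, x ∈ Z := MeasureTheory.ae_all_iff.2 hT
  have hZm : MeasurableSet Z := by
    have : Z = ⋂ φ : groupLanguage.Sentence, {x | (F.marked x).carrier ⊨ φ ↔ φ ∈ T} := by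
      ext x
      simp [hZdef]
    rw [this]
    exact MeasurableSet.iInter fun φ => (hms φ).iff (MeasurableSet.const _)
  -- A conull set for an atomless probability measure is uncountable, and an uncountable Borel set
  -- has the cardinality of the continuum.
  have hZc : #Z = 𝔠 := by
    have hnc : ¬ Countable Z := fun hc => by
      have h0 := (Set.countable_coe_iff.1 hc).measure_zero μ
      obtain ⟨x, hx, hx'⟩ := (hZ.and (MeasureTheory.measure_eq_zero_iff_ae_notMem.1 h0)).exists
      exact hx' hx
    have := hZm.standardBorel
    rw [Cardinal.mk_congr (PolishSpace.measurableEquivNatBoolOfNotCountable hnc).toEquiv]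
    simp
  let E : Setoid Z :=
    { r := fun x y => Nonempty ((F.marked x).carrier ≃* (F.marked y).carrier)
      iseqv := ⟨fun _ => ⟨MulEquiv.refl _⟩, fun ⟨e⟩ => ⟨e.symm⟩, fun ⟨e⟩ ⟨f⟩ => ⟨e.trans f⟩⟩ }
  have hQ : #(Quotient E) = 𝔠 := by
    refine le_antisymm (hZc ▸ Cardinal.mk_quotient_le) ?_
    -- The classes are countable, so fewer than continuum many of them cannot cover Z.
    by_contra! hlt
    have hle : #Z ≤ #(Quotient E) * ℵ₀ := by
      refine Cardinal.mk_le_mk_mul_of_mk_preimage_le (Quotient.mk E) fun q => ?_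
      refine Cardinal.le_aleph0_iff_set_countable.2 ?_
      refine ((F.countable_setOf_equiv q.out).preimage Subtype.val_injective).mono fun x hx => ?_
      exact Quotient.exact ((Set.mem_singleton_iff.1 hx).trans q.out_eq.symm)
    have : #Z < 𝔠 := hle.trans_lt (Cardinal.mul_lt_of_lt Cardinal.aleph0_le_continuum hlt
      Cardinal.aleph0_lt_continuum)
    exact this.ne hZc
  let f : Quotient E → GrpCat.{u} := fun q => GrpCat.of (F.marked q.out).carrier
  have hf : ∀ q r, Nonempty (f q ≃* f r) → q = r := fun q r h => by
    rw [← q.out_eq, ← r.out_eq]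
    exact Quotient.sound h
  refine ⟨Set.range f, ?_, ?_, ?_, ?_⟩
  · have hinj : Function.Injective f := fun q r h => by
      have key : ∀ A B : GrpCat.{u}, A = B → Nonempty (A ≃* B) := by
        rintro A _ rfl
        exact ⟨MulEquiv.refl _⟩
      exact hf q r (key _ _ h)
    have := Cardinal.mk_range_eq_of_injective hinj
    rw [hQ] at this
    simpa using this
  · rintro _ ⟨q, rfl⟩
    exact ⟨hC _, (F.marked _).group_fg⟩
  · rintro _ ⟨q, rfl⟩ _ ⟨r, rfl⟩ hne
    exact ⟨fun e => hne (congrArg f (hf q r ⟨e⟩))⟩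
  · rintro _ ⟨q, rfl⟩ _ ⟨r, rfl⟩
    rw [elementarilyEquivalent_iff]
    exact fun φ => (q.out.2 φ).trans (r.out.2 φ).symm

end TailFamily

/-! ### Sparse sequences -/

/-- An infinite countable group contains a sequence such that every nontrivial left translation
maps only finitely many of its terms to other terms. -/
lemma exists_sparse_seq (Q : Type*) [Group Q] [Countable Q] [Infinite Q] :
    ∃ p : ℕ → Q, Function.Injective p ∧
      ∀ g ≠ 1, ∃ N, ∀ i j, p i = g * p j → i < N ∧ j < N := by
  classical
  obtain ⟨e, he⟩ := exists_surjective_nat Q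
  -- Greedy choice of pairs (stage, element) with increasing stages: the new element avoids the
  -- finitely many translates of earlier ones by `e j` and its inverse, for j up to its stage.
  obtain ⟨f, -, hf⟩ := exists_seq_of_forall_finset_exists (α := ℕ × Q) (fun _ => True)
    (fun x y => x.1 < y.1 ∧ x.2 ≠ y.2 ∧ ∀ j ≤ y.1, y.2 ≠ e j * x.2 ∧ x.2 ≠ e j * y.2) (by
      intro s _
      let m := s.sup Prod.fst + 1
      obtain ⟨y, hy⟩ := Infinite.exists_notMem_finset
        (s.image Prod.snd ∪ (s ×ˢ Finset.range (m + 1)).image (fun z => e z.2 * z.1.2) ∪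
          (s ×ˢ Finset.range (m + 1)).image (fun z => (e z.2)⁻¹ * z.1.2))
      simp only [Finset.mem_union, Finset.mem_image, Finset.mem_product, Finset.mem_range,
        not_or, not_exists, not_and] at hy
      refine ⟨(m, y), trivial, fun x hx => ⟨Nat.lt_succ_of_le (Finset.le_sup (f := Prod.fst) hx),
        hy.1.1 x hx, fun j hj => ⟨fun h => ?_, fun h => ?_⟩⟩⟩
      · exact hy.1.2 (x, j) ⟨hx, Nat.lt_succ_of_le hj⟩ h.symm
      · exact hy.2 (x, j) ⟨hx, Nat.lt_succ_of_le hj⟩ (by simp [h]))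
  have hmono : ∀ i, i ≤ (f i).1 :=
    fun i => (strictMono_nat_of_lt_succ (f := fun i => (f i).1)
      fun i => (hf i (i + 1) (Nat.lt_succ_self i)).1).le_apply
  refine ⟨fun i => (f i).2, fun i j hij => ?_, fun g hg => ?_⟩
  · rcases lt_trichotomy i j with h | h | h
    · exact absurd hij (hf i j h).2.1
    · exact h
    · exact absurd hij.symm (hf j i h).2.1
  · obtain ⟨J, rfl⟩ := he g
    -- Stages grow at least as fast as indices, so translation by `e J` is excluded as soon as the
    -- later of the two indices reaches J.
    refine ⟨J, fun i j h => ?_⟩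
    rcases lt_trichotomy i j with hij | rfl | hij
    · have : j < J := by
        by_contra! hJ
        exact ((hf i j hij).2.2 J (hJ.trans (hmono j))).2 h
      omega
    · exact absurd (by simpa using h) hg
    · have : i < J := by
        by_contra! hJ
        exact ((hf j i hij).2.2 J (hJ.trans (hmono i))).1 h
      omega

/-! ### Words in a wreath product -/

namespace RegularWreathProduct

variable {M Q ι : Type*} [Group M] [Group Q]

lemma right_lift {ρ : ι → Q} {c : ι → M ≀ᵣ Q} (hc : ∀ i, (c i).right = ρ i) (w : FreeGroup ι) :
    (FreeGroup.lift c w).right = FreeGroup.lift ρ w := by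
  have : (rightHom : M ≀ᵣ Q →* Q).comp (FreeGroup.lift c) = FreeGroup.lift ρ := by
    ext i
    simp [hc]
  exact DFunLike.congr_fun this w

/-- The base component of the value of a word at a point depends only on the base components of
the letters in a finite window around this point. -/
lemma exists_window (ρ : ι → Q) (w : FreeGroup ι) :
    ∃ S : Finset Q, ∀ c c' : ι → M ≀ᵣ Q, (∀ i, (c i).right = ρ i) → (∀ i, (c' i).right = ρ i) →
      ∀ q q', (∀ s ∈ S, ∀ i, (c i).left (s * q) = (c' i).left (s * q')) →
        (FreeGroup.lift c w).left q = (FreeGroup.lift c' w).left q' := by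
  classical
  induction w using FreeGroup.induction_on with
  | C1 => exact ⟨∅, fun c c' _ _ q q' _ => by simp⟩
  | of i =>
    refine ⟨{1}, fun c c' _ _ q q' h => ?_⟩
    simpa using h 1 (by simp) i
  | inv_of i ih =>
    obtain ⟨S, hS⟩ := ih
    -- At q, the inverse of a letter reads that letter at `ρ i * q`, so the window is translated on
    -- the right. In the product case below, the second factor is likewise read at the inverse value
    -- of v times q.
    refine ⟨S.image (· * ρ i), fun c c' hc hc' q q' h => ?_⟩
    have := hS c c' hc hc' (ρ i * q) (ρ i * q') fun s hs j => by
      simpa [mul_assoc] using h (s * ρ i) (Finset.mem_image_of_mem _ hs) j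
    simpa [hc, hc'] using this
  | mul v w hv hw =>
    obtain ⟨S, hS⟩ := hv
    obtain ⟨S', hS'⟩ := hw
    refine ⟨S ∪ S'.image (· * (FreeGroup.lift ρ v)⁻¹), fun c c' hc hc' q q' h => ?_⟩
    have h1 := hS c c' hc hc' q q' fun s hs => h s (Finset.mem_union_left _ hs)
    have h2 := hS' c c' hc hc' ((FreeGroup.lift ρ v)⁻¹ * q) ((FreeGroup.lift ρ v)⁻¹ * q')
      fun s hs j => by
        simpa [mul_assoc] using
          h (s * (FreeGroup.lift ρ v)⁻¹) (Finset.mem_union_right _ (Finset.mem_image_of_mem _ hs)) j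
    simp only [map_mul, mul_left, Pi.mul_apply, right_lift hc, right_lift hc', h1, h2]

lemma inl_mul_mk_mul_inl_inv [DecidableEq Q] (q : Q) (b : M) :
    (inl q * ⟨Pi.mulSingle 1 b, 1⟩ * (inl q)⁻¹ : M ≀ᵣ Q) = ⟨Pi.mulSingle q b, 1⟩ := by
  ext t
  · by_cases h : t = q
    · subst h
      simp
    · have : q⁻¹ * t ≠ 1 := fun h' => h (inv_mul_eq_one.1 h').symm
      simp [h, this]
  · simp

end RegularWreathProduct

/-! ### Varieties -/

lemma SatisfiesLaws.of_injective {L : Set (FreeGroup ℕ)} {G : Type u} {H : Type v} [Group G]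
    [Group H] (h : SatisfiesLaws L H) (f : G →* H) (hf : Function.Injective f) :
    SatisfiesLaws L G := fun w hw φ => hf (by
  rw [map_one]
  exact h w hw (f.comp φ))

lemma SatisfiesLaws.pi {L : Set (FreeGroup ℕ)} {ι : Type v} {G : Type u} [Group G]
    (h : SatisfiesLaws L G) : SatisfiesLaws L (ι → G) := fun w hw φ =>
  funext fun i => h w hw ((Pi.evalMonoidHom _ i).comp φ)

/-- The kernel of the projection to Q embeds into a power of M, and the quotient embeds into Q; laws
pass to powers and subgroups. -/
lemma productClass_of_subgroup_wreath {U V : GroupClass.{u}} (hU : IsVariety U) (hV : IsVariety V)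
    {M Q : Type u} [Group M] [Group Q] (hM : U M) (hQ : V Q) (H : Subgroup (M ≀ᵣ Q)) :
    productClass U V H := by
  obtain ⟨L, hL⟩ := hU
  obtain ⟨L', hL'⟩ := hV
  let π : H →* Q := RegularWreathProduct.rightHom.comp H.subtype
  have hπ : ∀ g : π.ker, g.1.1.right = 1 := fun g => g.2
  refine ⟨π.ker, inferInstance, (hL _).2 ?_, (hL' _).2 ?_⟩
  · let l : π.ker →* (Q → M) :=
      { toFun := fun g => g.1.1.left
        map_one' := rfl
        map_mul' := fun g h => by
          ext q
          simp [hπ] }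
    refine (((hL M).1 hM).pi (ι := Q)).of_injective l fun g h hgh => ?_
    exact Subtype.ext (Subtype.ext (RegularWreathProduct.ext hgh ((hπ g).trans (hπ h).symm)))
  · exact ((hL' Q).1 hQ).of_injective _ (QuotientGroup.kerLift_injective π)

/-! ### The tail family in a wreath product -/

/-- The condition determining the `n`-th sign: the signs with indices divisible by `3` are
prescribed by `x`, and among the remaining ones both values occur infinitely often. -/
def signAt (x : ℕ → ZMod 2) (n : ℕ) : Prop := (n % 3 = 0 ∧ x (n / 3) = 1) ∨ n % 3 = 1

lemma signAt_congr {x y : ℕ → ZMod 2} {n : ℕ} (h : x (n / 3) = y (n / 3)) :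
    signAt x n ↔ signAt y n := by
  rw [signAt, signAt, h]

lemma exists_signAt_iff (x y : ℕ → ZMod 2) (i N : ℕ) : ∃ j ≥ N, (signAt x j ↔ signAt y i) := by
  by_cases h : signAt y i
  · exact ⟨3 * N + 1, by omega, iff_of_true (Or.inr (by omega)) h⟩
  · refine ⟨3 * N + 2, by omega, iff_of_false ?_ h⟩
    rintro (⟨h, -⟩ | h) <;> omega

namespace RegularWreathProduct

variable {M Q : Type u} [Group M]

open Classical in
/-- The function on `Q` equal to `a` at the terms of `p` with positive sign and trivial
elsewhere. -/
noncomputable def signFun (p : ℕ → Q) (a : M) (x : ℕ → ZMod 2) (q : Q) : M :=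
  if ∃ n, p n = q ∧ signAt x n then a else 1

lemma signFun_apply {p : ℕ → Q} (hp : Function.Injective p) (a : M) (x y : ℕ → ZMod 2) {i j : ℕ}
    (h : signAt x i ↔ signAt y j) : signFun p a x (p i) = signFun p a y (p j) := by
  have key : ∀ z k, (∃ n, p n = p k ∧ signAt z n) ↔ signAt z k := fun z k =>
    ⟨fun ⟨n, hn, h⟩ => hp hn ▸ h, fun h => ⟨k, rfl, h⟩⟩
  classical
  unfold signFun
  exact if_congr ((key x i).trans (h.trans (key y j).symm)) rfl rfl

lemma signFun_of_forall_ne {p : ℕ → Q} (a : M) (x : ℕ → ZMod 2) {q : Q} (h : ∀ n, p n ≠ q) :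
    signFun p a x q = 1 :=
  if_neg fun ⟨n, hn, _⟩ => h n hn

lemma signFun_eq_or (p : ℕ → Q) (a : M) (x : ℕ → ZMod 2) (q : Q) :
    signFun p a x q = a ∨ signFun p a x q = 1 := by
  unfold signFun
  split_ifs <;> simp

variable [Group Q]

open Classical in
/-- The tuple consisting of `signFun p a x`, the elements `a` and `b` of the base group supported at
`1`, and the tuple `s` of elements of the top group. -/
noncomputable def signTuple (p : ℕ → Q) (a b : M) {k : ℕ} (s : Fin k → Q) (x : ℕ → ZMod 2) :
    Fin (k + 3) → M ≀ᵣ Q :=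
  Fin.cons ⟨signFun p a x, 1⟩ (Fin.cons ⟨Pi.mulSingle 1 a, 1⟩ (Fin.cons ⟨Pi.mulSingle 1 b, 1⟩
    fun i => inl (s i)))

variable {p : ℕ → Q} {a b : M} {k : ℕ} {s : Fin k → Q}

lemma right_signTuple (x : ℕ → ZMod 2) (i : Fin (k + 3)) :
    (signTuple p a b s x i).right = (signTuple p a b s 0 i).right := by
  refine Fin.cases rfl (fun i => ?_) i
  refine Fin.cases rfl (fun i => ?_) i
  exact Fin.cases rfl (fun i => rfl) i

lemma left_signTuple_eq {x y : ℕ → ZMod 2} {q q' : Q}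
    (h : signFun p a x q = signFun p a y q') (h1 : q = 1 ↔ q' = 1) (i : Fin (k + 3)) :
    (signTuple p a b s x i).left q = (signTuple p a b s y i).left q' := by
  classical
  have key : ∀ c : M, (Pi.mulSingle 1 c : Q → M) q = (Pi.mulSingle 1 c : Q → M) q' := fun c => by
    simp only [Pi.mulSingle_apply, h1]
  refine Fin.cases h (fun i => ?_) i
  refine Fin.cases (key a) (fun i => ?_) i
  refine Fin.cases (key b) (fun i => ?_) i
  rfl

/-- For large N, a window that contains a term of index at least N contains no other term and not
the identity. What a word computes there depends only on the sign of that term, and the same picture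
occurs elsewhere for x. Other windows see only terms of index below N, whose signs are fixed by the
first N coordinates. -/
lemma exists_forall_lift_signTuple_eq_one (hp : Function.Injective p)
    (hsparse : ∀ g ≠ 1, ∃ N, ∀ i j, p i = g * p j → i < N ∧ j < N) (w : FreeGroup (Fin (k + 3))) :
    ∃ N, ∀ x y : ℕ → ZMod 2, (∀ i < N, x i = y i) →
      FreeGroup.lift (signTuple p a b s x) w = 1 → FreeGroup.lift (signTuple p a b s y) w = 1 := by
  obtain ⟨S, hS⟩ := exists_window (M := M) (fun i => (signTuple p a b s 0 i).right) w
  have hN1 : ∀ᶠ N in Filter.atTop, ∀ t ∈ S, ∀ t' ∈ S, t ≠ t' →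
      ∀ i j, p i = t * t'⁻¹ * p j → i < N ∧ j < N := by
    rw [Filter.eventually_all_finset]
    intro t _
    rw [Filter.eventually_all_finset]
    intro t' _
    by_cases h : t = t'
    · simp [h]
    · obtain ⟨N, hN⟩ := hsparse (t * t'⁻¹) (fun h' => h (mul_inv_eq_one.1 h'))
      filter_upwards [Filter.eventually_ge_atTop N] with K hK _ i j hij
      have := hN i j hij
      omega
  -- This keeps far terms away from the identity, where the generators carrying a and b are
  -- supported.
  have hN2 : ∀ᶠ N in Filter.atTop, ∀ t ∈ S, ∀ t' ∈ S, ∀ i, p i = t * t'⁻¹ → i < N := by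
    rw [Filter.eventually_all_finset]
    intro t _
    rw [Filter.eventually_all_finset]
    intro t' _
    by_cases h : ∃ i, p i = t * t'⁻¹
    · obtain ⟨i, hi⟩ := h
      filter_upwards [Filter.eventually_gt_atTop i] with K hK j hj
      rwa [hp (hj.trans hi.symm)]
    · exact Filter.Eventually.of_forall fun K i hi => absurd ⟨i, hi⟩ h
  obtain ⟨N, hN1, hN2⟩ := (hN1.and hN2).exists
  refine ⟨N, fun x y hxy hx => ?_⟩
  have hleft : ∀ q, (FreeGroup.lift (signTuple p a b s x) w).left q = 1 := fun q => by
    rw [hx]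
    rfl
  have hright := right_lift (right_signTuple (p := p) (a := a) (b := b) (s := s) x) w
  rw [hx] at hright
  refine RegularWreathProduct.ext (funext fun q => ?_)
    ((right_lift (right_signTuple y) w).trans hright.symm)
  change _ = (1 : M)
  by_cases hq : ∃ t ∈ S, ∃ i ≥ N, p i = t * q
  · obtain ⟨t, ht, i, hi, hpi⟩ := hq
    -- The window at q for y looks like the window at `t⁻¹ * p j` for x, where the word is known to
    -- be trivial.
    obtain ⟨j, hj, hij⟩ := exists_signAt_iff x y i N
    rw [← hleft (t⁻¹ * p j)]
    have hne : ∀ t' ∈ S, t' ≠ t → ∀ l ≥ N, ∀ r, p l = t * r → ∀ z,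
        signFun p a z (t' * r) = 1 ∧ t' * r ≠ 1 := by
      intro t' ht' htt l hl r hlr z
      have hr : r = t⁻¹ * p l := by rw [hlr, inv_mul_cancel_left]
      refine ⟨signFun_of_forall_ne a z fun m hm => ?_, fun h => ?_⟩
      · have := (hN1 t' ht' t ht htt m l (by rw [hm, hr, mul_assoc])).2
        omega
      · have := hN2 t ht t' ht' l (by rw [hlr, eq_inv_of_mul_eq_one_right h])
        omega
    have hp1 : ∀ l ≥ N, p l ≠ 1 := fun l hl h => by
      have := hN2 t ht t ht l (by simp [h])
      omega
    refine hS _ _ (right_signTuple y) (right_signTuple x) _ _ fun t' ht' => ?_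
    by_cases htt : t' = t
    · subst htt
      rw [← hpi, mul_inv_cancel_left]
      exact left_signTuple_eq (signFun_apply hp a y x hij.symm)
        (iff_of_false (hp1 i hi) (hp1 j hj))
    · obtain ⟨h1, h2⟩ := hne t' ht' htt i hi q hpi y
      obtain ⟨h3, h4⟩ := hne t' ht' htt j hj (t⁻¹ * p j) (by simp) x
      exact left_signTuple_eq (h1.trans h3.symm) (iff_of_false h2 h4)
  · push Not at hq
    rw [← hleft q]
    refine hS _ _ (right_signTuple y) (right_signTuple x) _ _ fun t ht =>
      left_signTuple_eq ?_ Iff.rfl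
    by_cases h : ∃ i, p i = t * q
    · obtain ⟨i, hi⟩ := h
      have hiN : i < N := by
        by_contra! hiN
        exact hq t ht i hiN hi
      rw [← hi]
      exact signFun_apply hp a y x (signAt_congr (hxy _ ((Nat.div_le_self i 3).trans_lt hiN)).symm)
    · push Not at h
      rw [signFun_of_forall_ne a y h, signFun_of_forall_ne a x h]

lemma isClopen_setOf_lift_signTuple (hp : Function.Injective p)
    (hsparse : ∀ g ≠ 1, ∃ N, ∀ i j, p i = g * p j → i < N ∧ j < N) (w : FreeGroup (Fin (k + 3))) :
    IsClopen {x | FreeGroup.lift (signTuple p a b s x) w = 1} := by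
  obtain ⟨N, hN⟩ := exists_forall_lift_signTuple_eq_one (a := a) (b := b) (s := s) hp hsparse w
  have hcyl : ∀ x : ℕ → ZMod 2, ∀ᶠ y in nhds x, ∀ i < N, x i = y i := fun x => by
    have h : ∀ᶠ y in nhds x, ∀ i ∈ Finset.range N, x i = y i := by
      rw [Filter.eventually_all_finset]
      intro i _
      have : ∀ᶠ c in nhds (x i), x i = c := by simp
      exact (continuous_apply i).tendsto x |>.eventually this
    simpa using h
  refine ⟨⟨isOpen_iff_mem_nhds.2 fun x hx => ?_⟩, isOpen_iff_mem_nhds.2 fun x hx => ?_⟩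
  · filter_upwards [hcyl x] with y hy hy'
    exact hx (hN y x (fun i hi => (hy i hi).symm) hy')
  · filter_upwards [hcyl x] with y hy
    exact hN x y hy hx

open Classical in
lemma exists_lift_signTuple_eq_mulSingle (hs : Subgroup.closure (Set.range s) = ⊤) (q : Q)
    (j : Fin (k + 3)) (c : M) (hj : ∀ x, signTuple p a b s x j = ⟨Pi.mulSingle 1 c, 1⟩) :
    ∃ v : FreeGroup (Fin (k + 3)),
      ∀ x, FreeGroup.lift (signTuple p a b s x) v = ⟨Pi.mulSingle q c, 1⟩ := by
  obtain ⟨u, rfl⟩ : q ∈ (FreeGroup.lift s).range := by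
    rw [FreeGroup.range_lift_eq_closure, hs]
    trivial
  let u' : FreeGroup (Fin (k + 3)) := FreeGroup.map (fun i => i.succ.succ.succ) u
  have hu' : ∀ x, FreeGroup.lift (signTuple p a b s x) u' = inl (FreeGroup.lift s u) := fun x => by
    have : (FreeGroup.lift (signTuple p a b s x)).comp
        (FreeGroup.map (fun i : Fin k => i.succ.succ.succ)) =
        (inl : Q →* M ≀ᵣ Q).comp (FreeGroup.lift s) := by
      ext i
      · simp [signTuple]
      · simp [signTuple]
    exact DFunLike.congr_fun this u
  refine ⟨u' * FreeGroup.of j * u'⁻¹, fun x => ?_⟩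
  rw [map_mul, map_mul, map_inv, hu', FreeGroup.lift_apply_of, hj, inl_mul_mk_mul_inl_inv]

lemma eq_of_forall_lift_signTuple (hp : Function.Injective p) (hab : a * b ≠ b * a)
    (hs : Subgroup.closure (Set.range s) = ⊤) (x y : ℕ → ZMod 2)
    (h : ∀ w, FreeGroup.lift (signTuple p a b s x) w = 1 ↔
      FreeGroup.lift (signTuple p a b s y) w = 1) : x = y := by
  classical
  have key : ∀ n, ∃ w : FreeGroup (Fin (k + 3)), ∀ z : ℕ → ZMod 2,
      FreeGroup.lift (signTuple p a b s z) w = 1 ↔ ¬ z n = 1 := by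
    intro n
    obtain ⟨v, hv⟩ := exists_lift_signTuple_eq_mulSingle (p := p) (a := a) (b := b) hs (p (3 * n)) 2 b
      fun x => rfl
    -- The commutator of the sign function with b supported at `p (3 * n)` is trivial exactly when
    -- the value there commutes with b; that value is a or 1, according to the coordinate n.
    refine ⟨FreeGroup.of 0 * v * (FreeGroup.of 0)⁻¹ * v⁻¹, fun z => ?_⟩
    have h0 : signTuple p a b s z 0 = ⟨signFun p a z, 1⟩ := rfl
    rw [map_mul, map_mul, map_mul, map_inv, map_inv, hv, FreeGroup.lift_apply_of, h0,
      mul_inv_eq_one, mul_inv_eq_iff_eq_mul]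
    have hsign : signFun p a z (p (3 * n)) = if z n = 1 then a else 1 := by
      have : (∃ m, p m = p (3 * n) ∧ signAt z m) ↔ z n = 1 := by
        constructor
        · rintro ⟨m, hm, h⟩
          rw [hp hm] at h
          rcases h with ⟨-, h⟩ | h
          · simpa using h
          · omega
        · intro h
          exact ⟨_, rfl, Or.inl ⟨by omega, by simpa using h⟩⟩
      exact if_congr this rfl rfl
    constructor
    · intro hc hz
      have := congrFun (congrArg RegularWreathProduct.left hc) (p (3 * n))
      simp [hsign, hz] at this
      exact hab this
    · intro hz
      ext t
      · by_cases ht : t = p (3 * n)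
        · subst ht
          simp [hsign, hz]
        · simp [ht]
      · simp
  funext n
  obtain ⟨w, hw⟩ := key n
  have := (hw x).symm.trans ((h w).trans (hw y))
  generalize x n = c at *
  generalize y n = d at *
  revert c d
  decide

/-- Coordinates are changed one at a time. Coordinate m affects only the sign with index 3m, so the
sign function changes by a factor a, its inverse or 1 at `p (3 * m)`, and such factors are
conjugates of generators or their inverses. -/
lemma closure_signTuple_le (hp : Function.Injective p)
    (hs : Subgroup.closure (Set.range s) = ⊤) (F : Finset ℕ) : ∀ x y : ℕ → ZMod 2,
      (∀ n ∉ F, x n = y n) → Subgroup.closure (Set.range (signTuple p a b s y)) ≤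
        Subgroup.closure (Set.range (signTuple p a b s x)) := by
  classical
  induction F using Finset.induction_on with
  | empty =>
    intro x y h
    rw [funext fun n => h n (Finset.notMem_empty n)]
  | insert m F _ ih =>
    intro x y h
    refine le_trans ?_ (ih x (Function.update y m (x m)) fun n hn => ?_)
    · set y' := Function.update y m (x m) with hy'
      obtain ⟨v, hv⟩ := exists_lift_signTuple_eq_mulSingle (p := p) (a := a) (b := b) hs
        (p (3 * m)) 1 a fun x => rfl
      set H := Subgroup.closure (Set.range (signTuple p a b s y')) with hH
      have hvH : (⟨Pi.mulSingle (p (3 * m)) a, 1⟩ : M ≀ᵣ Q) ∈ H := by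
        rw [← hv y', hH, ← FreeGroup.range_lift_eq_closure]
        exact ⟨v, rfl⟩
      have hgen : ∀ i, signTuple p a b s y' i ∈ H := fun i => Subgroup.subset_closure ⟨i, rfl⟩
      have hc : ∃ c : M, (⟨Pi.mulSingle (p (3 * m)) c, 1⟩ : M ≀ᵣ Q) ∈ H ∧
          signFun p a y (p (3 * m)) = signFun p a y' (p (3 * m)) * c := by
        have hinv : (⟨Pi.mulSingle (p (3 * m)) a⁻¹, 1⟩ : M ≀ᵣ Q) ∈ H := by
          convert H.inv_mem hvH using 1
          ext t <;> simp [Pi.mulSingle_inv]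
        have hone : (⟨Pi.mulSingle (p (3 * m)) 1, 1⟩ : M ≀ᵣ Q) ∈ H := by
          rw [Pi.mulSingle_one]
          exact H.one_mem
        rcases signFun_eq_or p a y (p (3 * m)) with h1 | h1 <;>
          rcases signFun_eq_or p a y' (p (3 * m)) with h2 | h2 <;> rw [h1, h2]
        exacts [⟨1, hone, by simp⟩, ⟨a, hvH, by simp⟩, ⟨a⁻¹, hinv, by simp⟩, ⟨1, hone, by simp⟩]
      obtain ⟨c, hcH, hc⟩ := hc
      have h0 : (⟨signFun p a y, 1⟩ : M ≀ᵣ Q) =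
          ⟨signFun p a y', 1⟩ * ⟨Pi.mulSingle (p (3 * m)) c, 1⟩ := by
        ext t
        · by_cases ht : t = p (3 * m)
          · subst ht
            simp [hc]
          · have : signFun p a y t = signFun p a y' t := by
              by_cases hn : ∃ n, p n = t
              · obtain ⟨n, rfl⟩ := hn
                have hnm : n ≠ 3 * m := fun h => ht (h ▸ rfl)
                refine signFun_apply hp a y y' ?_
                by_cases h3 : n % 3 = 0
                · refine signAt_congr ?_
                  rw [hy', Function.update_of_ne (by omega)]
                · simp [signAt, h3]
              · push Not at hn
                rw [signFun_of_forall_ne a y hn, signFun_of_forall_ne a y' hn]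
            simp [ht, this]
        · simp
      refine (Subgroup.closure_le _).2 ?_
      rintro _ ⟨i, rfl⟩
      refine Fin.cases ?_ (fun i => hgen i.succ) i
      change (⟨signFun p a y, 1⟩ : M ≀ᵣ Q) ∈ H
      rw [h0]
      exact H.mul_mem (hgen 0) hcH
    · by_cases hnm : n = m
      · subst hnm
        simp
      · rw [Function.update_of_ne hnm]
        exact h n (by simp [hnm, hn])

/-- The tail family in the wreath product of a nonabelian group with an infinite group. -/
noncomputable def tailFamily (hp : Function.Injective p)
    (hsparse : ∀ g ≠ 1, ∃ N, ∀ i j, p i = g * p j → i < N ∧ j < N) (hab : a * b ≠ b * a)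
    (hs : Subgroup.closure (Set.range s) = ⊤) : TailFamily (M ≀ᵣ Q) (k + 3) where
  tuple := signTuple p a b s
  isClopen_setOf := isClopen_setOf_lift_signTuple hp hsparse
  eq_of_forall_iff := eq_of_forall_lift_signTuple hp hab hs
  closure_eq x y h := le_antisymm
    (closure_signTuple_le hp hs h.toFinset _ _ fun n hn => by
      by_contra hne
      exact hn (h.mem_toFinset.2 (Ne.symm hne)))
    (closure_signTuple_le hp hs h.toFinset _ _ fun n hn => by
      by_contra hne
      exact hn (h.mem_toFinset.2 hne))

end RegularWreathProduct

/-! ### Application to product varieties -/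

lemma exists_tailFamily {U V : GroupClass.{u}} (hU : IsVariety U) (hV : IsVariety V)
    (hUab : ¬ IsAbelianClass U) (hVlf : ¬ IsLocallyFiniteClass V) :
    ∃ (W : Type u) (_ : Group W) (n : ℕ) (F : TailFamily W n),
      ∀ x, productClass U V (F.marked x).carrier := by
  simp only [IsAbelianClass, IsLocallyFiniteClass, IsLocallyFiniteGroup, not_forall] at hUab hVlf
  obtain ⟨M, _, hM, a, b, hab⟩ := hUab
  obtain ⟨R, _, hR, Q, hQ, hinf⟩ := hVlf
  -- The top group is the infinite finitely generated subgroup itself; it inherits the laws of V.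
  have hVQ : V Q := by
    obtain ⟨L, hL⟩ := hV
    exact (hL _).2 (((hL R).1 hR).of_injective Q.subtype Q.subtype_injective)
  have : Infinite Q := not_finite_iff_infinite.1 hinf
  have hfg : Group.FG Q := (Group.fg_iff_subgroup_fg Q).2 hQ
  obtain ⟨S, hS, hSfin⟩ := Group.fg_iff.1 hfg
  obtain ⟨k, s, -, rfl⟩ := hSfin.fin_param
  let X : MarkedGroup.{u} k := ⟨Q, s, hS⟩
  have : Countable Q := X.eval_surjective.countable
  obtain ⟨p, hp, hsparse⟩ := exists_sparse_seq Q
  exact ⟨M ≀ᵣ Q, inferInstance, k + 3, RegularWreathProduct.tailFamily hp hsparse hab hS,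
    fun x => productClass_of_subgroup_wreath hU hV hM hVQ _⟩

theorem corollary1 (U V : GroupClass.{u}) (hU : IsVariety U) (hV : IsVariety V)
    (hUab : ¬ IsAbelianClass U) (hVlf : ¬ IsLocallyFiniteClass V) :
    (∃ (G : Type u) (_ : Group G), productClass U V G ∧ IsCondensed G) ∧
    ¬ IsSmoothRel.{u + 1, w}
        (isoRel.{u}.comap (Subtype.val : markedGroupsIn (productClass U V) → MarkedSpace.{u})) ∧
    ∃ S : Set GrpCat.{u}, #S = 2 ^ ℵ₀ ∧
      (∀ G ∈ S, productClass U V G ∧ Group.FG G) ∧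
      (∀ G ∈ S, ∀ H ∈ S, G ≠ H → IsEmpty (G ≃* H)) ∧
      (∀ G ∈ S, ∀ H ∈ S, groupLanguage.ElementarilyEquivalent G H) := by
  obtain ⟨W, _, n, F, hF⟩ := exists_tailFamily hU hV hUab hVlf
  exact ⟨⟨_, _, hF 0, F.isCondensed⟩, F.not_isSmoothRel hF, F.exists_elementarilyEquivalent hF⟩
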